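/- Let $R \subseteq S$ be an extension of commutative rings, where $R$ is regular (that is, $R$ is Noetherian and $R_{\mathfrak p}$ is a regular local ring for every prime ideal $\mathfrak p$ of $R$) and $S$ is finitely generated and projective as an $R$-module. Let $\mathfrak m$ be a maximal ideal of $S$ and put $\mathfrak n = \mathfrak m \cap R$. Let $\mathfrak n S = Q_1 \cap Q_2 \cap \cdots \cap Q_c$ be a minimal primary decomposition of the ideal $\mathfrak n S$ of $S$, where $Q_1$ is $\mathfrak m$-primary. Then $S/Q_1$ has finite length $\ell_R(S/Q_1)$ as an $R$-module, and there is an isomorphism of $R$-modules \[ E_S\left(S/\mathfrak m\right) \;\cong\; E_R\left(R/\mathfrak n\right)^{\ell_R(S/Q_1)}, \] where $E_A(M)$ denotes the injective hull of a module $M$ over a ring $A$. -/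

import Mathlib

universe u v w w₁ w₂

/-- `i : M → E` exhibits the `A`-module `E` as an injective hull `E_A(M)` of `M`: the map `i` is
injective, `E` is an injective `A`-module, and `E` is an essential extension of the image of `i`,
i.e. every submodule of `E` that meets the image of `i` trivially is zero.

`Module.Injective A E` tests against modules in the universe of `E`; as soon as that universe
contains (a copy of) `A`, this is injectivity in the usual sense. -/
structure IsInjectiveHull {A : Type u} [Ring A] {M : Type v} [AddCommGroup M] [Module A M]
    {E : Type w} [AddCommGroup E] [Module A E] (i : M →ₗ[A] E) : Prop where
  injective : Function.Injective i
  module_injective : Module.Injective A E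
  essential : ∀ N : Submodule A E, N ⊓ LinearMap.range i = ⊥ → N = ⊥

/-- Every module has an injective hull. -/
theorem exists_isInjectiveHull (A : Type u) [Ring A] (M : Type v) [AddCommGroup M] [Module A M] :
    ∃ (E : Type (max u v)) (_ : AddCommGroup E) (_ : Module A E) (i : M →ₗ[A] E),
      IsInjectiveHull i := by
  classical
  -- an injective module containing `M`
  obtain ⟨J, _, _, hJ, k, hk⟩ : ∃ (J : Type (max u v)) (_ : AddCommGroup J) (_ : Module A J)
      (_ : Module.Injective A J) (k : M →ₗ[A] J), Function.Injective k := by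
    let X : ModuleCat.{max u v} A := ModuleCat.of A (ULift.{u} M)
    obtain ⟨P⟩ := CategoryTheory.EnoughInjectives.presentation X
    have h1 : CategoryTheory.Injective (ModuleCat.of A P.J) := P.injective
    have h2 := Module.injective_module_of_injective_object A P.J
    refine ⟨P.J, inferInstance, inferInstance, h2,
      P.f.hom ∘ₗ (ULift.moduleEquiv (R := A) (M := M)).symm.toLinearMap, ?_⟩
    have := (ModuleCat.mono_iff_injective P.f).1 P.mono
    exact this.comp (LinearEquiv.injective _)
  let B : Submodule A J := LinearMap.range k
  -- a maximal essential extension of `M` inside `J`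
  obtain ⟨E, hBE, hE⟩ := zorn_le_nonempty₀
    {E : Submodule A J | ∀ x ∈ E, x ≠ 0 → ∃ r : A, r • x ∈ B ∧ r • x ≠ 0}
    (fun c hc hchain y hy => ⟨sSup c, by
      intro x hx hx0
      obtain ⟨z, hz, hxz⟩ := (Submodule.mem_sSup_of_directed ⟨y, hy⟩ hchain.directedOn).1 hx
      exact hc hz x hxz hx0, fun z hz => le_sSup hz⟩)
    B (fun x hx hx0 => ⟨1, by simpa using hx, by simpa using hx0⟩)
  -- a maximal complement of it
  obtain ⟨C, -, hC⟩ := zorn_le_nonempty₀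
    {C : Submodule A J | ∀ x ∈ C, x ∈ E → x = 0}
    (fun c hc hchain y hy => ⟨sSup c, by
      intro x hx hxE
      obtain ⟨z, hz, hxz⟩ := (Submodule.mem_sSup_of_directed ⟨y, hy⟩ hchain.directedOn).1 hx
      exact hc hz x hxz hxE, fun z hz => le_sSup hz⟩)
    ⊥ (fun x hx _ => by simpa using hx)
  have hCE : ∀ j, j ∉ C → ∃ (r : A), ∃ e ∈ E, e ≠ 0 ∧ C.mkQ e = r • C.mkQ j := by
    intro j hj
    by_contra! hcon
    have hmem : C ⊔ Submodule.span A {j} ∈ {C : Submodule A J | ∀ x ∈ C, x ∈ E → x = 0} := by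
      intro x hx hxE
      by_contra hx0
      obtain ⟨c, hc, y, hy, rfl⟩ := Submodule.mem_sup.1 hx
      obtain ⟨r, rfl⟩ := Submodule.mem_span_singleton.1 hy
      refine hcon r _ hxE hx0 ?_
      have h0 : C.mkQ c = 0 := by simpa using hc
      rw [map_add, h0, zero_add, map_smul]
    exact hj (hC.2 hmem le_sup_left (Submodule.mem_sup_right (Submodule.mem_span_singleton_self j)))
  obtain ⟨h, hh⟩ := Module.Injective.out (C.mkQ ∘ₗ E.subtype) (by
    rw [← LinearMap.ker_eq_bot, LinearMap.ker_eq_bot']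
    intro m hm
    have h0 : (m : J) ∈ C := by simpa using hm
    exact Subtype.ext (hC.1 _ h0 m.2)) E.subtype
  have hh' : ∀ e ∈ E, h (C.mkQ e) = e := fun e he => hh ⟨e, he⟩
  have hrange : LinearMap.range h ≤ E := by
    refine hE.2 ?_ ?_
    · rintro _ ⟨q, rfl⟩ hy
      obtain ⟨j, rfl⟩ := C.mkQ_surjective q
      have hj : j ∉ C := by
        intro hj
        have h0 : C.mkQ j = 0 := by simpa using hj
        exact hy (by rw [h0, map_zero])
      obtain ⟨r, e, heE, he0, her⟩ := hCE j hj
      obtain ⟨s, hs, hs0⟩ := hE.1 e heE he0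
      have : (s * r) • h (C.mkQ j) = s • e := by
        rw [mul_smul, ← map_smul h r, ← her, hh' e heE]
      exact ⟨s * r, this ▸ hs, this ▸ hs0⟩
    · intro e he
      exact ⟨_, hh' e he⟩
  let p : J →ₗ[A] E := (h ∘ₗ C.mkQ).codRestrict E (fun x => hrange ⟨_, rfl⟩)
  have hp : ∀ e : E, p e = e := fun e => Subtype.ext (hh' e e.2)
  refine ⟨E, inferInstance, inferInstance, k.codRestrict E (fun x => hBE ⟨x, rfl⟩), ?_, ?_, ?_⟩
  · intro x y hxy
    exact hk (congrArg Subtype.val hxy)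
  · refine ⟨fun X Y _ _ _ _ f hf g => ?_⟩
    obtain ⟨g', hg'⟩ := Module.Injective.out f hf (E.subtype ∘ₗ g)
    refine ⟨p ∘ₗ g', fun x => ?_⟩
    rw [LinearMap.comp_apply, hg']
    exact hp _
  · intro N hN
    rw [Submodule.eq_bot_iff]
    intro x hx
    by_contra hx0
    obtain ⟨r, ⟨m, hm⟩, hr0⟩ := hE.1 x.1 x.2 (fun h0 => hx0 (Subtype.ext h0))
    have : r • x ∈ N ⊓ LinearMap.range (k.codRestrict E (fun x => hBE ⟨x, rfl⟩)) :=
      ⟨N.smul_mem r hx, m, Subtype.ext hm⟩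
    rw [hN, Submodule.mem_bot] at this
    exact hr0 (congrArg Subtype.val this)

/-! Write `n` for the contraction of `m`, `E` for the hull over `S` and `F` for the hull over `R`.
As `S` is projective, hence flat, `Hom_R(-, E) = Hom_S(S ⊗ -, E)` is exact, so `E` is injective over
`R`. Each element of `E` is killed by a power of `m`, hence of `n`, and an `n`-power torsion
injective module is determined by the dimension over `R ⧸ n` of its socle, the elements killed by
`n`: dimension `l` gives `F^l` (`nonempty_linearEquiv_pi_of_length_torsionBySet`). It remains to
measure the socle. Elements of `E` see only the `m`-primary part of `nS`, so the socle is `Hom_S(S ⧸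
Q₁, E)`, the Matlis dual of `S ⧸ Q₁`, and by dévissage it has the same `R`-length as `S ⧸ Q₁`
(`IsInjectiveHull.length_hom`). -/

/-! ### Torsion and socle of the hull of a residue field -/

namespace IsInjectiveHull

variable {A : Type u} [CommRing A] {I : Ideal A} {E : Type w} [AddCommGroup E] [Module A E]
  {i : (A ⧸ I) →ₗ[A] E}

/-- A nonzero element of an injective hull of `A ⧸ I` has a nonzero multiple in `A ⧸ I`. -/
theorem exists_smul_eq (hE : IsInjectiveHull i) {x : E} (hx : x ≠ 0) :
    ∃ (a : A) (z : A ⧸ I), a • x = i z ∧ a • x ≠ 0 := by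
  have h : A ∙ x ⊓ LinearMap.range i ≠ ⊥ := fun h =>
    hx (Submodule.span_singleton_eq_bot.1 (hE.essential _ h))
  obtain ⟨y, ⟨hy, z, hz⟩, hy0⟩ := (Submodule.ne_bot_iff _).1 h
  obtain ⟨a, rfl⟩ := Submodule.mem_span_singleton.1 hy
  exact ⟨a, z, hz.symm, hy0⟩

/-- The image of `A ⧸ I` in `E` is killed by `I`. -/
theorem smul_apply_eq_zero (i : (A ⧸ I) →ₗ[A] E) {a : A} (ha : a ∈ I) (z : A ⧸ I) :
    a • i z = 0 := by
  obtain ⟨b, rfl⟩ := Ideal.Quotient.mk_surjective z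
  rw [← map_smul, Algebra.smul_def, Ideal.Quotient.algebraMap_eq,
    Ideal.Quotient.eq_zero_iff_mem.2 ha, zero_mul, map_zero]

/-- Over a Noetherian ring, every element of the injective hull of `A ⧸ I`, with `I` maximal, is
killed by a power of `I`. -/
theorem exists_pow_smul_eq_zero [IsNoetherianRing A] [I.IsMaximal] (hE : IsInjectiveHull i)
    (x : E) : ∃ k : ℕ, ∀ a ∈ I ^ k, a • x = 0 := by
  -- A minimal prime over the annihilator of `x` is itself the annihilator of some nonzero `y`. A
  -- nonzero multiple of `y` lies in `A ⧸ I` and is killed by `I`, so primality puts `I` inside that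
  -- prime.
  have hrad : I ≤ ((⊥ : Submodule A E).colon {x}).radical := by
    rw [← Ideal.sInf_minimalPrimes]
    refine le_sInf fun p hp b hb => ?_
    obtain ⟨y, rfl⟩ := Submodule.exists_eq_colon_of_mem_minimalPrimes hp
    have hprime := Ideal.IsMinimalPrime.isPrime hp
    have hy : y ≠ 0 := by
      rintro rfl
      exact hprime.ne_top ((Ideal.eq_top_iff_one _).2 (by simp))
    obtain ⟨a, z, haz, ha0⟩ := hE.exists_smul_eq hy
    have hba : b * a ∈ (⊥ : Submodule A E).colon {y} := by
      rw [Submodule.mem_colon_singleton, Submodule.mem_bot, mul_smul, haz,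
        smul_apply_eq_zero i hb]
    refine (hprime.mem_or_mem hba).resolve_right fun ha => ha0 ?_
    rwa [Submodule.mem_colon_singleton, Submodule.mem_bot] at ha
  obtain ⟨k, hk⟩ := Ideal.exists_pow_le_of_le_radical_of_fg hrad (IsNoetherian.noetherian I)
  refine ⟨k, fun a ha => ?_⟩
  have := hk ha
  rwa [Submodule.mem_colon_singleton, Submodule.mem_bot] at this

/-- The elements of the injective hull of `A ⧸ I` killed by the maximal ideal `I` are those of
`A ⧸ I`. -/
theorem exists_apply_eq [I.IsMaximal] (hE : IsInjectiveHull i) {y : E}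
    (hy : ∀ a ∈ I, a • y = 0) : ∃ z, i z = y := by
  by_cases hy0 : y = 0
  · exact ⟨0, by rw [hy0, map_zero]⟩
  obtain ⟨a, z, haz, ha0⟩ := hE.exists_smul_eq hy0
  have ha : a ∉ I := fun h => ha0 (hy a h)
  obtain ⟨b, c, hc, hbc⟩ := Ideal.IsMaximal.exists_inv ‹_› ha
  refine ⟨b • z, ?_⟩
  rw [map_smul, ← haz, ← mul_smul, ← sub_eq_zero, ← neg_eq_zero, neg_sub]
  nth_rw 1 [← one_smul A y]
  rw [← sub_smul, ← hbc, add_sub_cancel_left, hy c hc]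

end IsInjectiveHull

/-! ### Injective modules and their socles -/

/-- An injective module over a flat algebra is injective over the base ring. -/
theorem Module.Baer.restrictScalars_of_flat {R : Type u} {S : Type v} [CommRing R] [CommRing S]
    [Algebra R S] [Module.Flat R S] {E : Type w} [AddCommGroup E] [Module S E] [Module R E]
    [IsScalarTower R S E] (hE : Module.Baer S E) : Module.Baer R E := by
  intro I g
  obtain ⟨h, hh⟩ := hE.extension_property (I.subtype.baseChange S)
    (Module.Flat.lTensor_preserves_injective_linearMap _ I.subtype_injective) (g.liftBaseChange S)
  refine ⟨h.restrictScalars R ∘ₗ TensorProduct.mk R S R 1, fun x hx => ?_⟩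
  simpa using LinearMap.congr_fun hh (1 ⊗ₜ[R] ⟨x, hx⟩)

theorem Module.Baer.pi {R : Type u} [CommRing R] {ι : Type*} {F : Type w} [AddCommGroup F]
    [Module R F] (hF : Module.Baer R F) : Module.Baer R (ι → F) := by
  intro I g
  choose h hh using fun k => hF I (LinearMap.proj k ∘ₗ g)
  exact ⟨LinearMap.pi h, fun x hx => funext fun k => hh k x hx⟩

/-- A nonzero element killed by a power of `n` has a nonzero multiple killed by `n`. -/
theorem exists_smul_mem_torsionBySet {R : Type u} [CommRing R] {n : Ideal R} {M : Type w}
    [AddCommGroup M] [Module R M] {x : M} (hx : x ≠ 0) {k : ℕ} (hk : ∀ a ∈ n ^ k, a • x = 0) :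
    ∃ r : R, r • x ≠ 0 ∧ r • x ∈ Submodule.torsionBySet R M (n : Set R) := by
  induction k with
  | zero => exact absurd (by simpa using hk 1 (by simp)) hx
  | succ k ih =>
    by_cases h : ∀ a ∈ n ^ k, a • x = 0
    · exact ih h
    push Not at h
    obtain ⟨r, hr, hr0⟩ := h
    refine ⟨r, hr0, (Submodule.mem_torsionBySet_iff _ _).2 fun a => ?_⟩
    rw [← mul_smul, mul_comm]
    exact hk _ (pow_succ n k ▸ Ideal.mul_mem_mul hr a.2)

/-- An `n`-power torsion injective module whose submodule of elements killed by `n` has finite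
length `l` is a direct sum of `l` copies of the injective hull of `R ⧸ n`. -/
theorem nonempty_linearEquiv_pi_of_length_torsionBySet {R : Type u} [CommRing R]
    [IsNoetherianRing R] {n : Ideal R} [n.IsMaximal] {E : Type v} [AddCommGroup E] [Module R E]
    (hE : Module.Baer R E) (htors : ∀ x : E, ∃ k : ℕ, ∀ a ∈ n ^ k, a • x = 0)
    {F : Type w} [AddCommGroup F] [Module R F] {j : (R ⧸ n) →ₗ[R] F} (hF : IsInjectiveHull j)
    (hFB : Module.Baer R F) {l : ℕ}
    (hl : Module.length R (Submodule.torsionBySet R E (n : Set R)) = l) :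
    Nonempty (E ≃ₗ[R] (Fin l → F)) := by
  let T := Submodule.torsionBySet R E (n : Set R)
  have hT : Module.IsTorsionBySet R T (n : Set R) := Submodule.torsionBySet_isTorsionBySet _
  let : Module (R ⧸ n) T := hT.module
  have : IsScalarTower R (R ⧸ n) T := hT.isScalarTower
  let : Field (R ⧸ n) := Ideal.Quotient.field n
  have hl' : Module.length (R ⧸ n) T = l := by
    rw [← hl]
    exact (Module.length_eq_of_surjective (S := R) (R := R ⧸ n) (M := T)
      Ideal.Quotient.mk_surjective).symm
  have hfin : Module.Finite (R ⧸ n) T := by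
    have h : IsFiniteLength (R ⧸ n) T := by
      rw [← Module.length_ne_top_iff, hl']
      exact ENat.natCast_ne_top l
    have := (isFiniteLength_iff_isNoetherian_isArtinian.1 h).1
    infer_instance
  have hrank : Module.finrank (R ⧸ n) T = l := by
    rw [Module.length_eq_finrank] at hl'
    exact_mod_cast hl'
  let e : T ≃ₗ[R] (Fin l → R ⧸ n) :=
    (LinearEquiv.restrictScalars R (Module.finBasisOfFinrankEq (R ⧸ n) T hrank).equivFun)
  let J : (Fin l → R ⧸ n) →ₗ[R] (Fin l → F) := LinearMap.pi fun k => j ∘ₗ LinearMap.proj k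
  have hJ : Function.Injective J := fun x y hxy =>
    funext fun k => hF.injective (congrFun hxy k)
  -- Extend the identification of the socles to all of `E`. A nonzero kernel would meet the socle,
  -- where the map is injective.
  obtain ⟨φ, hφ⟩ := (Module.Baer.pi (ι := Fin l) hFB).extension_property T.subtype
    T.subtype_injective (J ∘ₗ e.toLinearMap)
  have hφT : ∀ t : T, φ t = J (e t) := fun t => LinearMap.congr_fun hφ t
  have hφinj : Function.Injective φ := by
    rw [injective_iff_map_eq_zero]
    intro x hx
    by_contra hx0
    obtain ⟨k, hk⟩ := htors x
    obtain ⟨r, hr0, hrT⟩ := exists_smul_mem_torsionBySet hx0 hk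
    have h0 : J (e ⟨r • x, hrT⟩) = 0 := by rw [← hφT, map_smul, hx, smul_zero]
    rw [← map_zero J, hJ.eq_iff, map_eq_zero_iff _ e.injective] at h0
    exact hr0 (congrArg Subtype.val h0)
  obtain ⟨ρ, hρ⟩ := hE.extension_property φ hφinj LinearMap.id
  have hρφ : ∀ x, ρ (φ x) = x := fun x => LinearMap.congr_fun hρ x
  -- A nonzero kernel of the retraction would contain a nonzero socle element of `F^l`; but these
  -- all come from the socle of `E`, on which `ρ ∘ φ` is the identity.
  have hρinj : Function.Injective ρ := by
    rw [injective_iff_map_eq_zero]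
    intro x hx
    by_contra hx0
    choose k hk using fun s => hF.exists_pow_smul_eq_zero (x s)
    have hK : ∀ a ∈ n ^ (Finset.univ.sup k), a • x = 0 := fun a ha => funext fun s =>
      hk s a (Ideal.pow_le_pow_right (Finset.le_sup (Finset.mem_univ s)) ha)
    obtain ⟨r, hr0, hrT⟩ := exists_smul_mem_torsionBySet hx0 hK
    rw [Submodule.mem_torsionBySet_iff] at hrT
    choose z hz using fun s => hF.exists_apply_eq (y := (r • x) s)
      fun a ha => congrFun (hrT ⟨a, ha⟩) s
    have hz' : φ (e.symm z) = r • x := by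
      rw [hφT, e.apply_symm_apply]
      exact funext hz
    apply hr0
    have h1 := hρφ (e.symm z)
    rw [hz', map_smul, hx, smul_zero] at h1
    rw [← hz', ← h1, map_zero]
  exact ⟨LinearEquiv.ofBijective φ ⟨hφinj, fun y => ⟨ρ y, hρinj (hρφ _)⟩⟩⟩

/-! ### Matlis duality and length -/

section MatlisDuality

variable {R : Type u} {S : Type v} [CommRing R] [CommRing S] [Algebra R S]
  {m : Ideal S} [m.IsMaximal] {E : Type w} [AddCommGroup E] [Module S E] [Module R E]
  [IsScalarTower R S E] {i : (S ⧸ m) →ₗ[S] E}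

/-- The Matlis dual of the residue field is the residue field. -/
theorem IsInjectiveHull.nonempty_linearEquiv_hom (hE : IsInjectiveHull i) :
    Nonempty ((S ⧸ m) ≃ₗ[S] ((S ⧸ m) →ₗ[S] E)) := by
  let f : (S ⧸ m) →ₗ[S] ((S ⧸ m) →ₗ[S] E) := (LinearMap.mul S (S ⧸ m)).compr₂ i
  refine ⟨LinearEquiv.ofBijective f ⟨fun a b hab => hE.injective ?_, fun g => ?_⟩⟩
  · simpa [f] using LinearMap.congr_fun hab 1
  · obtain ⟨z, hz⟩ := hE.exists_apply_eq (y := g 1) fun a ha =>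
      IsInjectiveHull.smul_apply_eq_zero g ha 1
    refine ⟨z, LinearMap.ext fun b => ?_⟩
    obtain ⟨b, rfl⟩ := Ideal.Quotient.mk_surjective b
    have h1 : Ideal.Quotient.mk m b = b • (1 : S ⧸ m) := by
      rw [Algebra.smul_def, mul_one, Ideal.Quotient.algebraMap_eq]
    rw [h1, map_smul, map_smul, ← hz]
    simp [f]

/-- Matlis duality preserves the length of modules of finite length supported at `m`. -/
theorem IsInjectiveHull.length_hom (hE : IsInjectiveHull i) (hB : Module.Baer S E) (k : ℕ)
    {M : Type*} [AddCommGroup M] [Module S M] (hM : IsFiniteLength S M)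
    [instR : Module R M] [IsScalarTower R S M] (hk : ∀ a ∈ m ^ k, ∀ x : M, a • x = 0) :
    Module.length R (M →ₗ[S] E) = Module.length R M := by
  -- The `R`-structure is generalised so that the induction hypothesis applies to the submodule `N`
  -- with its own.
  revert instR
  induction hM with
  | of_subsingleton =>
    intros
    rw [Module.length_eq_zero, Module.length_eq_zero]
  | @of_simple_quotient M _ _ N hs _ ih =>
    intro _ _
    have ihN := ih fun a ha x => Subtype.ext (hk a ha x)
    obtain ⟨P, hP, ⟨e⟩⟩ := isSimpleModule_iff_quot_maximal.1 hs
    -- `m ^ k` kills the simple quotient, so `m ^ k ≤ P`; this leaves `S ⧸ m` as the only possible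
    -- composition factor.
    have hmP : m = P := by
      refine Ideal.IsMaximal.eq_of_le ‹_› hP.ne_top (hP.isPrime.le_of_pow_le (n := k) ?_)
      intro a ha
      have h1 : a • e.symm 1 = 0 := by
        obtain ⟨x, hx⟩ := N.mkQ_surjective (e.symm 1)
        rw [← hx, ← map_smul, hk a ha, map_zero]
      rw [← map_smul, map_eq_zero_iff _ e.symm.injective, Algebra.smul_def, mul_one] at h1
      exact Ideal.Quotient.eq_zero_iff_mem.1 h1
    subst hmP
    obtain ⟨d⟩ := hE.nonempty_linearEquiv_hom
    have hquot : Module.length R ((M ⧸ N) →ₗ[S] E) = Module.length R (M ⧸ N) := by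
      rw [(e.restrictScalars R).length_eq, (d.restrictScalars R).length_eq]
      exact ((LinearEquiv.congrLeft E R e)).length_eq
    rw [Module.length_eq_add_of_exact (N.mkQ.lcomp R E) (N.subtype.lcomp R E)
        (LinearMap.lcomp_injective_of_surjective _ N.mkQ_surjective)
        (fun g => hB.extension_property _ N.subtype_injective g) ?_,
      Module.length_eq_add_of_exact (N.subtype.restrictScalars R) (N.mkQ.restrictScalars R)
        N.subtype_injective N.mkQ_surjective
        (LinearMap.exact_subtype_mkQ N), hquot, ihN, add_comm]
    intro g
    constructor
    · intro hg
      have hle : N ≤ LinearMap.ker g := fun x hx => LinearMap.congr_fun hg ⟨x, hx⟩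
      exact ⟨N.liftQ g hle, N.liftQ_mkQ g hle⟩
    · rintro ⟨g, rfl⟩
      refine LinearMap.ext fun x => ?_
      change g (N.mkQ x) = 0
      rw [Submodule.mkQ_apply, (Submodule.Quotient.mk_eq_zero N).2 x.2, map_zero]

end MatlisDuality

/-! ### The primary component at `m` -/

section PrimaryComponent

variable {R : Type u} {S : Type v} [CommRing R] [CommRing S] [Algebra R S]

/-- In an integral extension, the intersection of the primary components of `(m ∩ R) S` other than
the `m`-primary one is not contained in `m`. -/
theorem inf_erase_not_le_of_isMinimalPrimaryDecomposition [Algebra.IsIntegral R S]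
    [DecidableEq (Ideal S)] {m : Ideal S} [m.IsMaximal] {t : Finset (Ideal S)}
    (ht : Submodule.IsMinimalPrimaryDecomposition ((m.under R).map (algebraMap R S)) t)
    {Q : Ideal S} (hQ : Q ∈ t) (hQm : Q.radical = m) : ¬ (t.erase Q).inf id ≤ m := by
  intro hle
  obtain ⟨Q', hQ', hQ'm⟩ := (Ideal.IsMaximal.isPrime ‹m.IsMaximal›).inf_le'.1 hle
  obtain ⟨hne, hQ't⟩ := Finset.mem_erase.1 hQ'
  have hprime : Q'.radical.IsPrime :=
    Ideal.isPrime_radical (ht.primary hQ't)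
  have hle' : Q'.radical ≤ m := (Ideal.IsMaximal.isPrime ‹m.IsMaximal›).radical_le_iff.2 hQ'm
  have hn : m.under R ≤ Q'.radical.under R := by
    rw [Ideal.under, ← Ideal.map_le_iff_le_comap]
    refine le_trans ?_ Ideal.le_radical
    rw [← ht.inf_eq]
    exact Finset.inf_le hQ't
  have hunder : m.under R = Q'.radical.under R :=
    Ideal.IsMaximal.eq_of_le inferInstance (Ideal.IsPrime.under R Q'.radical).ne_top hn
  -- By integrality a prime over the maximal ideal `m.under R` is maximal. Hence this radical equals
  -- `m`, against the distinctness of radicals in a minimal decomposition.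
  have hmax : Q'.radical.IsMaximal := by
    refine Ideal.isMaximal_of_isIntegral_of_isMaximal_comap (R := R) _ ?_
    change (Q'.radical.under R).IsMaximal
    rw [← hunder]
    infer_instance
  refine ht.distinct hQ't hQ hne ?_
  change (Submodule.colon Q' _).radical = (Submodule.colon Q _).radical
  rw [Submodule.colon_univ, Submodule.colon_univ, hQm]
  exact hmax.eq_of_le (Ideal.IsMaximal.ne_top ‹_›) hle'

/-- An ideal lying above a maximal ideal has a quotient of finite length, for a finite algebra. -/
theorem isFiniteLength_quotient_of_map_le [IsNoetherianRing R] [Module.Finite R S] {n : Ideal R}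
    [n.IsMaximal] {Q : Ideal S} (hQ : n.map (algebraMap R S) ≤ Q) : IsFiniteLength R (S ⧸ Q) := by
  have hT : Module.IsTorsionBySet R (S ⧸ Q) (n : Set R) := fun x a => by
    obtain ⟨s, rfl⟩ := Ideal.Quotient.mk_surjective x
    have : (a : R) • (Ideal.Quotient.mk Q s) = Ideal.Quotient.mk Q (algebraMap R S a * s) := by
      rw [← Algebra.smul_def]; rfl
    rw [this, Ideal.Quotient.eq_zero_iff_mem]
    exact Q.mul_mem_right s (hQ (Ideal.mem_map_of_mem _ a.2))
  let : Module (R ⧸ n) (S ⧸ Q) := hT.module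
  have : IsScalarTower R (R ⧸ n) (S ⧸ Q) := hT.isScalarTower
  let : Field (R ⧸ n) := Ideal.Quotient.field n
  have : Module.Finite (R ⧸ n) (S ⧸ Q) := Module.Finite.of_restrictScalars_finite R _ _
  have : IsArtinian (R ⧸ n) (S ⧸ Q) := inferInstance
  exact isFiniteLength_iff_isNoetherian_isArtinian.2
    ⟨inferInstance, isArtinian_of_surjective_algebraMap (R := R ⧸ n) Ideal.Quotient.mk_surjective⟩

/-- Elements of `E_S(S ⧸ m)` killed by `m ∩ R` are killed by the `m`-primary component of
`(m ∩ R) S`, and form the Matlis dual of the quotient by that component. -/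
theorem IsInjectiveHull.nonempty_hom_linearEquiv_torsionBySet [IsNoetherianRing S]
    [Algebra.IsIntegral R S]
    {m : Ideal S} [m.IsMaximal] {t : Finset (Ideal S)}
    (ht : Submodule.IsMinimalPrimaryDecomposition ((m.under R).map (algebraMap R S)) t)
    {Q : Ideal S} (hQ : Q ∈ t) (hQm : Q.radical = m)
    {E : Type w} [AddCommGroup E] [Module S E] [Module R E] [IsScalarTower R S E]
    {i : (S ⧸ m) →ₗ[S] E} (hE : IsInjectiveHull i) :
    Nonempty (((S ⧸ Q) →ₗ[S] E) ≃ₗ[R]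
      Submodule.torsionBySet R E ((m.under R : Ideal R) : Set R)) := by
  classical
  have hnQ : (m.under R).map (algebraMap R S) ≤ Q := by
    rw [← ht.inf_eq]
    exact Finset.inf_le hQ
  have hker : ∀ x ∈ Submodule.torsionBySet R E ((m.under R : Ideal R) : Set R),
      ∀ q ∈ Q, q • x = 0 := by
    intro x hx q hq
    rw [Submodule.mem_torsionBySet_iff] at hx
    have hxn : (m.under R).map (algebraMap R S) ≤ (⊥ : Submodule S E).colon {x} := by
      rw [Ideal.map_le_iff_le_comap]
      intro a ha
      rw [Ideal.mem_comap, Submodule.mem_colon_singleton, algebraMap_smul]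
      exact hx ⟨a, ha⟩
    obtain ⟨k, hk⟩ := hE.exists_pow_smul_eq_zero x
    -- Thus `1 = a + b` with `a` killing `x` and `b` in all the other components; then `q * b` lies
    -- in the extended ideal, which kills `x`, so `q • x = 0`.
    have htop : m ^ k ⊔ (t.erase Q).inf id = ⊤ := Ideal.pow_sup_eq_top
      ((Ideal.isMaximal_def.1 ‹m.IsMaximal›).2 _ <| left_lt_sup.2
        (inf_erase_not_le_of_isMinimalPrimaryDecomposition ht hQ hQm))
    obtain ⟨a, ha, b, hb, hab⟩ := Submodule.mem_sup.1 ((Ideal.eq_top_iff_one _).1 htop)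
    have hqb : q * b ∈ (m.under R).map (algebraMap R S) := by
      rw [← ht.inf_eq, ← Finset.insert_erase hQ, Finset.inf_insert]
      exact ⟨Q.mul_mem_right b hq, Ideal.mul_mem_left _ q hb⟩
    have h2 := hxn hqb
    rw [Submodule.mem_colon_singleton, Submodule.mem_bot] at h2
    rw [← one_smul S x, ← hab, add_smul, hk a ha, zero_add, ← mul_smul, h2]
  let f : ((S ⧸ Q) →ₗ[S] E) →ₗ[R] E :=
    { toFun := fun g => g 1
      map_add' := fun _ _ => rfl
      map_smul' := fun _ _ => rfl }
  have hf : ∀ g, f g ∈ Submodule.torsionBySet R E ((m.under R : Ideal R) : Set R) := by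
    intro g
    rw [Submodule.mem_torsionBySet_iff]
    intro a
    rw [← algebraMap_smul S]
    exact IsInjectiveHull.smul_apply_eq_zero g (hnQ (Ideal.mem_map_of_mem _ a.2)) 1
  refine ⟨LinearEquiv.ofBijective (f.codRestrict _ hf) ⟨fun g h hgh => ?_, fun x => ?_⟩⟩
  · have h1 : g 1 = h 1 := congrArg Subtype.val hgh
    refine LinearMap.ext fun b => ?_
    obtain ⟨b, rfl⟩ := Ideal.Quotient.mk_surjective b
    have hb : Ideal.Quotient.mk Q b = b • (1 : S ⧸ Q) := by
      rw [Algebra.smul_def, mul_one, Ideal.Quotient.algebraMap_eq]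
    rw [hb, map_smul, map_smul, h1]
  · have hle : Q ≤ LinearMap.ker (LinearMap.toSpanSingleton S E (x : E)) := fun q hq =>
      hker x x.2 q hq
    refine ⟨Submodule.liftQ Q _ hle, Subtype.ext ?_⟩
    change Submodule.liftQ Q _ hle (Q.mkQ 1) = x
    rw [Submodule.mkQ_apply, Submodule.liftQ_apply, LinearMap.toSpanSingleton_apply, one_smul]

end PrimaryComponent

/-! ### The structure of the hull over the base ring -/

theorem theorem4 {R : Type u} {S : Type v} [CommRing R] [CommRing S] [Algebra R S]
    (hRS : Function.Injective (algebraMap R S)) [IsRegularRing R]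
    [Module.Finite R S] [Module.Projective R S]
    (m : Ideal S) [m.IsMaximal]
    (t : Finset (Ideal S))
    (ht : Submodule.IsMinimalPrimaryDecomposition ((m.under R).map (algebraMap R S)) t)
    (Q₁ : Ideal S) (hQ₁ : Q₁ ∈ t) (hQ₁m : Q₁.radical = m)
    {E : Type (max v w₁)} [AddCommGroup E] [Module S E] [Module R E] [IsScalarTower R S E]
    (i : (S ⧸ m) →ₗ[S] E) (hE : IsInjectiveHull i)
    {F : Type (max u w₂)} [AddCommGroup F] [Module R F]
    (j : (R ⧸ m.under R) →ₗ[R] F) (hF : IsInjectiveHull j) :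
    ∃ l : ℕ, Module.length R (S ⧸ Q₁) = l ∧ Nonempty (E ≃ₗ[R] (Fin l → F)) := by
  have : IsNoetherianRing S := IsNoetherianRing.of_finite R S
  have hEB : Module.Baer S E := Module.Baer.of_injective hE.module_injective
  have hFB : Module.Baer R F := Module.Baer.of_injective hF.module_injective
  have hnQ : (m.under R).map (algebraMap R S) ≤ Q₁ := by
    rw [← ht.inf_eq]
    exact Finset.inf_le hQ₁
  have hfin : IsFiniteLength R (S ⧸ Q₁) := isFiniteLength_quotient_of_map_le hnQ
  obtain ⟨l, hl⟩ := ENat.ne_top_iff_exists.1 (Module.length_ne_top_iff.2 hfin)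
  refine ⟨l, hl.symm, ?_⟩
  have hfinS : IsFiniteLength S (S ⧸ Q₁) := isFiniteLength_iff_isNoetherian_isArtinian.2
    ⟨inferInstance, isArtinian_of_tower R (isFiniteLength_iff_isNoetherian_isArtinian.1 hfin).2⟩
  obtain ⟨k, hk⟩ := Ideal.exists_pow_le_of_le_radical_of_fg hQ₁m.ge (IsNoetherian.noetherian m)
  obtain ⟨e⟩ := hE.nonempty_hom_linearEquiv_torsionBySet ht hQ₁ hQ₁m
  refine nonempty_linearEquiv_pi_of_length_torsionBySet (hEB.restrictScalars_of_flat (R := R))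
    (fun x => ?_) hF hFB (l := l) ?_
  · obtain ⟨d, hd⟩ := hE.exists_pow_smul_eq_zero x
    refine ⟨d, fun a ha => ?_⟩
    rw [← algebraMap_smul S]
    refine hd _ (Ideal.pow_right_mono (Ideal.map_comap_le (f := algebraMap R S)) d ?_)
    rw [← Ideal.map_pow]
    exact Ideal.mem_map_of_mem _ ha
  · rw [← e.length_eq, hE.length_hom hEB k hfinS, hl]
    intro a ha x
    exact IsInjectiveHull.smul_apply_eq_zero LinearMap.id (hk ha) x
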